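/- Let $\mathcal X$ be a measurable space, $P\neq Q$ probability measures on $\mathcal X$, $\mu=\frac{P+Q}{2}$, and let $$\chi_2(P,Q)=\Big\|\frac{dP}{d\mu}-\frac{dQ}{d\mu}\Big\|_{L_2(\mu)},\qquad f_\chi=\frac{1}{\chi_2(P,Q)}\Big(\frac{dP}{d\mu}-\frac{dQ}{d\mu}\Big)$$ be their Chi-squared distance and the optimal critic. Let $\mathcal H$ be a class of measurable functions $f:\mathcal X\to\mathbb R$ with $\|f\|_\infty\le\nu$ for all $f\in\mathcal H$, where $\nu>0$. Assume that $\mathcal H$ is pointwise separable (it has a countable subset such that every $f\in\mathcal H$ is the pointwise limit of a sequence from this subset) and that some $f\in\mathcal H$ has $\|f\|_{L_2(\mu)}=1$. Let $N,M\ge1$, $n=\frac{MN}{M+N}$, and let $S=(x_1,\dots,x_N,y_1,\dots,y_M)$ be independent with $x_i\sim P$, $y_j\sim Q$. Put $$\mathcal E(f)=E_Pf-E_Qf,\quad \hat{\mathcal E}(f)=\frac1N\sum_{i=1}^N f(x_i)-\frac1M\sum_{j=1}^M f(y_j),\quad \hat\Omega(f)=\frac1{2N}\sum_{i=1}^N f(x_i)^2+\frac1{2M}\sum_{j=1}^M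 f(y_j)^2,$$ $$\hat{\mathcal L}(f,\lambda)=\hat{\mathcal E}(f)+\frac\lambda2\big(1-\hat\Omega(f)\big),$$ and, for $\mathcal F\subset\mathcal H$, $$\mathcal R(\mathcal F,S)=E_\sigma\sup_{f\in\mathcal F}\Big[\frac1N\sum_{i=1}^N\sigma_if(x_i)-\frac1M\sum_{j=1}^M\sigma_{N+j}f(y_j)\Big],$$ where $\sigma_1,\dots,\sigma_{N+M}$ are independent uniform signs and $S$ is held fixed. There are universal constants $c_1,c_2,c_3,c_4>0$, and for all $\nu>0,\tau>0,\Lambda\ge0$ a constant $C$ that depends only on $\nu,\tau,\Lambda$, such that for all $\mathcal X,P,Q,\mathcal H,N,M$ as above the following holds with probability at least $1-12e^{-\tau}$ over $S$. Let $\hat f\in\arg\max_{f\in\mathcal H,\ \hat\Omega(f)=1}\hat{\mathcal E}(f)$, let $(\hat f,\hat\lambda)$ be a saddle point of $\hat{\mathcal L}$ on $\mathcal H\times[0,\infty)$, that is, $\hat{\mathcal L}(f,\hat\lambda)\le\hat{\mathcal L}(\hat f,\hat\lambda)\le\hat{\mathcal L}(\hat f,\lambda)$ for all $f\in\mathcal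 H$, $\lambda\ge0$, with $0\le\hat\lambda\le\Lambda$, and let $\eta_n\ge c_1\nu\,\mathcal R(\mathcal H,S)+c_2\frac{\nu^2\tau}{n}$. Then $$\frac{\chi_2(P,Q)-\mathcal E(\hat f)}{\chi_2(P,Q)}\le\frac12\inf_{f\in\mathcal H,\ \|f\|_{L_2(\mu)}=1}\|f-f_\chi\|^2_{L_2(\mu)}+\frac{\varepsilon_n}{\chi_2(P,Q)},$$ where $$\varepsilon_n=c_3\,\mathcal R\big(\{f\in\mathcal H:\hat\Omega(f)\le1+\nu^2+2\eta_n\},S\big)+c_4(1+2\nu\hat\lambda)\,\mathcal R\big(\{f\in\mathcal H:\hat\Omega(f)\le1+\tfrac{\nu^2}{2}+\eta_n\},S\big)+\frac{C}{\sqrt n}.$$ -/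

import Mathlib

open MeasureTheory Filter Topology

noncomputable section

namespace FisherIPM

variable {X : Type*}

/-! ### Population quantities -/

section Population

variable [MeasurableSpace X]

/-- The mixture `(P + Q) / 2`. -/
def mixture (P Q : Measure X) : Measure X := (2⁻¹ : ENNReal) • (P + Q)

/-- The norm of `L₂(X, μ)`, for functions. -/
def l2Norm (μ : Measure X) (f : X → ℝ) : ℝ := √(∫ x, f x ^ 2 ∂μ)

/-- The difference of the densities of `P` and `Q` with respect to `(P + Q) / 2`
(every probability measure `P` is absolutely continuous with respect to `(P + Q) / 2`). -/
def densityDiff (P Q : Measure X) (x : X) : ℝ :=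
  (P.rnDeriv (mixture P Q) x).toReal - (Q.rnDeriv (mixture P Q) x).toReal

/-- The Chi-squared distance: the norm in `L₂(X, (P + Q) / 2)` of the difference of the
densities of `P` and `Q` with respect to `(P + Q) / 2`. -/
def chi2 (P Q : Measure X) : ℝ := l2Norm (mixture P Q) (densityDiff P Q)

/-- The optimal critic at full capacity. -/
def optimalCritic (P Q : Measure X) (x : X) : ℝ := (1 / chi2 P Q) * densityDiff P Q x

/-- The expected mean discrepancy `𝓔(f) = E_P f - E_Q f`. -/
def meanDiscrepancy (P Q : Measure X) (f : X → ℝ) : ℝ := (∫ x, f x ∂P) - ∫ x, f x ∂Q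

/-- The unit sphere of `L₂(X, (P + Q) / 2)`. -/
def unitSphere (P Q : Measure X) : Set (X → ℝ) := {f | l2Norm (mixture P Q) f = 1}

/-- The approximation error of the optimal critic in `H`:
half the squared `L₂` distance of the optimal critic from `H ∩ sphere`. -/
def approximationError (P Q : Measure X) (H : Set (X → ℝ)) : ℝ :=
  (1 / 2) * ⨅ f : ↥(H ∩ unitSphere P Q),
    l2Norm (mixture P Q) (fun x => f.1 x - optimalCritic P Q x) ^ 2

/-- The law of the sample: `N` draws from `P` and `M` draws from `Q`, all independent. -/
def sampleLaw (P Q : Measure X) (N M : ℕ) : Measure ((Fin N → X) × (Fin M → X)) :=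
  (Measure.pi fun _ : Fin N => P).prod (Measure.pi fun _ : Fin M => Q)

end Population

/-! ### Empirical quantities, for a sample `S = (x₁, …, x_N, y₁, …, y_M)` -/

variable {N M : ℕ}

/-- The empirical mean discrepancy. -/
def empMeanDiscrepancy (S : (Fin N → X) × (Fin M → X)) (f : X → ℝ) : ℝ :=
  (1 / (N : ℝ)) * ∑ i, f (S.1 i) - (1 / (M : ℝ)) * ∑ j, f (S.2 j)

/-- The empirical second order moment. -/
def empOmega (S : (Fin N → X) × (Fin M → X)) (f : X → ℝ) : ℝ :=
  (1 / (2 * (N : ℝ))) * ∑ i, f (S.1 i) ^ 2 + (1 / (2 * (M : ℝ))) * ∑ j, f (S.2 j) ^ 2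

/-- The empirical Lagrangian. -/
def empLagrangian (S : (Fin N → X) × (Fin M → X)) (f : X → ℝ) (lam : ℝ) : ℝ :=
  empMeanDiscrepancy S f + (lam / 2) * (1 - empOmega S f)

/-- `f` maximizes the empirical mean discrepancy over `H` under the constraint that the
empirical second order moment is `1`. -/
def IsEmpiricalCritic (H : Set (X → ℝ)) (S : (Fin N → X) × (Fin M → X)) (f : X → ℝ) : Prop :=
  f ∈ H ∧ empOmega S f = 1 ∧
    ∀ g ∈ H, empOmega S g = 1 → empMeanDiscrepancy S g ≤ empMeanDiscrepancy S f

/-- `(f, lam)` is a saddle point of the empirical Lagrangian on `H × [0, ∞)`. -/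
def IsEmpiricalSaddlePoint (H : Set (X → ℝ)) (S : (Fin N → X) × (Fin M → X))
    (f : X → ℝ) (lam : ℝ) : Prop :=
  f ∈ H ∧ 0 ≤ lam ∧
    (∀ g ∈ H, empLagrangian S g lam ≤ empLagrangian S f lam) ∧
    (∀ l : ℝ, 0 ≤ l → empLagrangian S f lam ≤ empLagrangian S f l)

/-- The pooled sample `X₁, …, X_{N+M}`. -/
def pooled (S : (Fin N → X) × (Fin M → X)) : Fin N ⊕ Fin M → X := Sum.elim S.1 S.2

/-- The weights: `1 / N` on the first sample, `-1 / M` on the second one. -/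
def weight (N M : ℕ) : Fin N ⊕ Fin M → ℝ :=
  Sum.elim (fun _ => 1 / (N : ℝ)) (fun _ => -1 / (M : ℝ))

/-- The data dependent Rademacher complexity of the class `F`: the average, over the
`2 ^ (N + M)` equally likely sign vectors `σ`, of the supremum over `f ∈ F` of the
signed weighted sum. -/
def rademacher (F : Set (X → ℝ)) (S : (Fin N → X) × (Fin M → X)) : ℝ :=
  (1 / 2 ^ (N + M)) * ∑ σ : Fin N ⊕ Fin M → ℤˣ,
    ⨆ f : ↥F, ∑ i, ((σ i : ℤ) : ℝ) * weight N M i * f.1 (pooled S i)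

/-- The functions of `H` whose empirical second order moment is at most `r`. -/
def empSublevel (H : Set (X → ℝ)) (S : (Fin N → X) × (Fin M → X)) (r : ℝ) : Set (X → ℝ) :=
  {f | f ∈ H ∧ empOmega S f ≤ r}

/-- `n = M N / (M + N)`. -/
def effectiveSize (N M : ℕ) : ℝ := ((M : ℝ) * N) / ((M : ℝ) + N)

/-- The usual regularity of a class over which suprema of empirical processes are taken:
some countable subset is sequentially dense for pointwise convergence. -/
def PointwiseSeparable (H : Set (X → ℝ)) : Prop :=
  ∃ H₀ ⊆ H, H₀.Countable ∧ ∀ f ∈ H, ∃ u : ℕ → X → ℝ,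
    (∀ k, u k ∈ H₀) ∧ ∀ x, Tendsto (fun k => u k x) atTop (𝓝 (f x))

end FisherIPM

end

open FisherIPM

/-! Fix, before sampling, a member `f₀` of the class on the population sphere whose relative loss is
within `1/(√n χ₂)` of the approximation error; on the sphere the loss `(χ₂ - 𝓔(f))/χ₂` is exactly
half the squared distance to the optimal critic (`half_sq_l2Norm_sub_optimalCritic`). What remains
is `𝓔(f₀) - 𝓔(f̂) = [𝓔(f₀) - 𝓔̂(f₀)] + [𝓔̂(f₀) - 𝓔̂(f̂)] + [𝓔̂(f̂) - 𝓔(f̂)]`.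

The first bracket concerns one fixed function: Hoeffding. In the second, `f₀` need not satisfy the
empirical constraint, but the saddle inequality at `f₀`, with `Ω̂(f̂) = 1`, bounds it by
`(λ̂/2)(Ω̂(f₀) - 1)`, again a Hoeffding deviation because `Ω̂(f₀)` has mean `1`. The third needs a
bound uniform over the class, with the data dependent Rademacher complexity: McDiarmid applied to
the supremum of the deviations minus twice the sign average, whose mean is nonpositive by
symmetrization (`measure_supDeviation_ge_le`).

No localization argument is needed: `Ω̂ ≤ ν²` on the class, so the sublevel in the first complexity
term is the whole class, and the second complexity term is nonnegative and can be added for free. -/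

open ProbabilityTheory
open scoped NNReal

/-! ### Concentration: bounded differences and McDiarmid's inequality. -/

/-- Tensorization of sub-Gaussian concentration along a product of two probability spaces. -/
lemma hasSubgaussianMGF_sub_integral_prod {α β : Type*} [MeasurableSpace α] [MeasurableSpace β]
    (p : Measure α) (q : Measure β) [IsProbabilityMeasure p] [IsProbabilityMeasure q]
    {G : α × β → ℝ} (hG : Measurable G) {B : ℝ} (hB : ∀ z, |G z| ≤ B) {c d : ℝ≥0}
    (h₁ : HasSubgaussianMGF (fun a => ∫ b, G (a, b) ∂q - ∫ a', ∫ b, G (a', b) ∂q ∂p) c p)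
    (h₂ : ∀ a, HasSubgaussianMGF (fun b => G (a, b) - ∫ b', G (a, b') ∂q) d q) :
    HasSubgaussianMGF (fun z => G z - ∫ z', G z' ∂(p.prod q)) (c + d) (p.prod q) := by
  have hGi : Integrable G (p.prod q) :=
    Integrable.of_bound hG.aestronglyMeasurable B (ae_of_all _ hB)
  have hE : ∫ z', G z' ∂(p.prod q) = ∫ a', ∫ b, G (a', b) ∂q ∂p := integral_prod _ hGi
  set E := ∫ z', G z' ∂(p.prod q)
  rw [← hE] at h₁
  have hexp : ∀ t : ℝ, Integrable (fun z => Real.exp (t * (G z - E))) (p.prod q) := by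
    intro t
    refine Integrable.of_bound (by fun_prop) (Real.exp (|t| * (B + |E|))) (ae_of_all _ fun z => ?_)
    rw [Real.norm_eq_abs, Real.abs_exp, Real.exp_le_exp]
    refine (le_abs_self _).trans ?_
    rw [abs_mul]
    gcongr
    exact (abs_sub _ _).trans (by gcongr; exact hB z)
  refine ⟨hexp, fun t => ?_⟩
  -- Given `a`, the deviation splits into that of the conditional mean and that around the
  -- conditional mean; the second has a moment generating function bounded uniformly in `a`.
  have key : ∀ a, ∫ b, Real.exp (t * (G (a, b) - E)) ∂q ≤
      Real.exp (t * (∫ b, G (a, b) ∂q - E)) * Real.exp (d * t ^ 2 / 2) := by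
    intro a
    calc ∫ b, Real.exp (t * (G (a, b) - E)) ∂q
        = ∫ b, Real.exp (t * (∫ b, G (a, b) ∂q - E)) *
            Real.exp (t * (G (a, b) - ∫ b', G (a, b') ∂q)) ∂q := by
          congr 1 with b
          rw [← Real.exp_add]
          ring_nf
      _ = Real.exp (t * (∫ b, G (a, b) ∂q - E)) *
            ∫ b, Real.exp (t * (G (a, b) - ∫ b', G (a, b') ∂q)) ∂q := integral_const_mul _ _
      _ ≤ _ := by gcongr; exact (h₂ a).mgf_le t
  calc ∫ z, Real.exp (t * (G z - E)) ∂(p.prod q)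
      = ∫ a, ∫ b, Real.exp (t * (G (a, b) - E)) ∂q ∂p := integral_prod _ (hexp t)
    _ ≤ ∫ a, Real.exp (t * (∫ b, G (a, b) ∂q - E)) * Real.exp (d * t ^ 2 / 2) ∂p :=
        integral_mono (hexp t).integral_prod_left ((h₁.integrable_exp_mul t).mul_const _) key
    _ = (∫ a, Real.exp (t * (∫ b, G (a, b) ∂q - E)) ∂p) * Real.exp (d * t ^ 2 / 2) :=
        integral_mul_const _ _
    _ ≤ Real.exp (c * t ^ 2 / 2) * Real.exp (d * t ^ 2 / 2) := by
        gcongr; exact h₁.mgf_le t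
    _ = Real.exp (((c + d : ℝ≥0) : ℝ) * t ^ 2 / 2) := by
        rw [← Real.exp_add]; push_cast; ring_nf

/-- Hoeffding's lemma for a function with oscillation at most `c`. -/
lemma hasSubgaussianMGF_of_oscillation_le {β : Type*} [MeasurableSpace β] (q : Measure β)
    [IsProbabilityMeasure q] {g : β → ℝ} (hg : Measurable g) {c : ℝ≥0}
    (hc : ∀ x y, |g x - g y| ≤ c) :
    HasSubgaussianMGF (fun b => g b - ∫ b', g b' ∂q) ((c / 2) ^ 2) q := by
  have hne : Nonempty β := nonempty_of_isProbabilityMeasure q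
  obtain ⟨x₀⟩ := hne
  have hbdd : BddBelow (Set.range g) :=
    ⟨g x₀ - c, by rintro _ ⟨y, rfl⟩; linarith [(abs_le.1 (hc x₀ y)).2]⟩
  have hmem : ∀ x, g x ∈ Set.Icc (⨅ y, g y) ((⨅ y, g y) + c) := by
    refine fun x => ⟨ciInf_le hbdd x, ?_⟩
    have : Nonempty β := ⟨x₀⟩
    have : g x - c ≤ ⨅ y, g y := le_ciInf fun y => by linarith [(abs_le.1 (hc x y)).2]
    linarith
  have := hasSubgaussianMGF_of_mem_Icc (μ := q) hg.aemeasurable (ae_of_all _ hmem)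
  simpa using this

/-- Sub-Gaussian concentration around the mean transfers along measure preserving maps. -/
lemma hasSubgaussianMGF_sub_integral_of_measurePreserving {α β : Type*} [MeasurableSpace α]
    [MeasurableSpace β] {p : Measure α} {q : Measure β} {T : α → β} (hT : MeasurePreserving T p q)
    {G : β → ℝ} (hG : Measurable G) {c : ℝ≥0}
    (h : HasSubgaussianMGF (fun z => G (T z) - ∫ z', G (T z') ∂p) c p) :
    HasSubgaussianMGF (fun z => G z - ∫ z', G z' ∂q) c q := by
  have hE : ∫ z', G z' ∂q = ∫ z', G (T z') ∂p := by
    rw [← hT.map_eq, integral_map hT.measurable.aemeasurable hG.aestronglyMeasurable]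
  rw [hE]
  generalize ∫ z', G (T z') ∂p = E at h
  have hm : ∀ t : ℝ, AEStronglyMeasurable (fun z => Real.exp (t * (G z - E))) q := fun t => by
    fun_prop
  refine ⟨fun t => ?_, fun t => ?_⟩
  · exact (hT.integrable_comp (hm t)).1 (h.integrable_exp_mul t)
  · refine le_trans (le_of_eq ?_) (h.mgf_le t)
    simp only [mgf]
    rw [← hT.map_eq, integral_map hT.measurable.aemeasurable (hT.map_eq ▸ hm t)]

/-- Moment generating function form of **McDiarmid's inequality**: a function of independent
variables with bounded differences is sub-Gaussian. -/
theorem hasSubgaussianMGF_of_bounded_differences {X : Type*} [MeasurableSpace X]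
    (ι : Type*) [Fintype ι] :
    ∀ (μ : ι → Measure X) [∀ i, IsProbabilityMeasure (μ i)] (c : ι → ℝ≥0) (G : (ι → X) → ℝ)
      (B : ℝ), Measurable G → (∀ z, |G z| ≤ B) →
      (∀ i x y, (∀ j, j ≠ i → x j = y j) → |G x - G y| ≤ c i) →
      HasSubgaussianMGF (fun z => G z - ∫ z', G z' ∂(Measure.pi μ)) (∑ i, (c i / 2) ^ 2)
        (Measure.pi μ) := by
  -- Induction on the index type: relabelling, no coordinate, one more coordinate.
  refine Fintype.induction_empty_option (P := fun ι _ =>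
    ∀ (μ : ι → Measure X) [∀ i, IsProbabilityMeasure (μ i)] (c : ι → ℝ≥0) (G : (ι → X) → ℝ)
      (B : ℝ), Measurable G → (∀ z, |G z| ≤ B) →
      (∀ i x y, (∀ j, j ≠ i → x j = y j) → |G x - G y| ≤ c i) →
      HasSubgaussianMGF (fun z => G z - ∫ z', G z' ∂(Measure.pi μ)) (∑ i, (c i / 2) ^ 2)
        (Measure.pi μ)) ?_ ?_ ?_ ι
  · intro α β _ e ih μ _ c G B hG hB hc
    let _ := Fintype.ofEquiv β e.symm
    have happ : ∀ (z : α → X) (b : β), MeasurableEquiv.piCongrLeft (fun _ : β => X) e z b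
        = z (e.symm b) := by
      intro z b
      obtain ⟨a, rfl⟩ := e.surjective b
      simp [MeasurableEquiv.coe_piCongrLeft]
    rw [← e.sum_comp]
    refine hasSubgaussianMGF_sub_integral_of_measurePreserving
      (measurePreserving_piCongrLeft μ e) hG ?_
    refine ih (fun i => μ (e i)) (fun i => c (e i))
      (fun z => G (MeasurableEquiv.piCongrLeft (fun _ : β => X) e z)) B
      (hG.comp (MeasurableEquiv.measurable _)) (fun z => hB _) fun i x y hxy => ?_
    refine hc (e i) _ _ fun j hj => ?_
    rw [happ, happ]
    exact hxy _ fun h => hj (by simp [← h])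
  · intro μ _ c G B hG hB hc
    have : (fun z => G z - ∫ z', G z' ∂(Measure.pi μ)) = fun _ => 0 := by
      ext z
      have : ∀ z', G z' = G z := fun z' => congrArg G (Subsingleton.elim _ _)
      simp [this]
    rw [this]
    simp [HasSubgaussianMGF.fun_zero]
  · intro α _ ih μ _ c G B hG hB hc
    let e := (MeasurableEquiv.piOptionEquivProd (fun _ : Option α => X)).symm
    have hmp : MeasurePreserving e ((Measure.pi fun i ↦ μ (some i)).prod (μ none))
      (Measure.pi μ) := ⟨e.measurable, Measure.pi_map_piOptionEquivProd μ⟩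
    have hsome : ∀ z i, e z (some i) = z.1 i := fun _ _ => rfl
    have hnone : ∀ z, e z none = z.2 := fun _ => rfl
    have hGe : Measurable fun z => G (e z) := hG.comp e.measurable
    have hint : ∀ a, Integrable (fun b => G (e (a, b))) (μ none) := fun a =>
      Integrable.of_bound (hGe.comp measurable_prodMk_left).aestronglyMeasurable B
        (ae_of_all _ fun b => hB _)
    rw [Fintype.sum_option, add_comm]
    refine hasSubgaussianMGF_sub_integral_of_measurePreserving hmp hG ?_
    refine hasSubgaussianMGF_sub_integral_prod _ _ hGe (fun z => hB (e z)) ?_ fun a => ?_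
    -- Averaging out the new coordinate preserves the bounded differences in the old ones.
    · refine ih (fun i => μ (some i)) (fun i => c (some i)) (fun a => ∫ b, G (e (a, b)) ∂μ none) B
        (hGe.stronglyMeasurable.integral_prod_right.measurable) (fun a => ?_) fun i x y hxy => ?_
      · simpa using norm_integral_le_of_norm_le_const (μ := μ none)
          (f := fun b => G (e (a, b))) (C := B) (ae_of_all _ fun b => hB (e (a, b)))
      · rw [← integral_sub (hint x) (hint y)]
        have := norm_integral_le_of_norm_le_const (μ := μ none)
          (f := fun b => G (e (x, b)) - G (e (y, b))) (C := c (some i))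
          (ae_of_all _ fun b => hc (some i) _ _ fun j hj => ?_)
        · simpa using this
        · cases j with
          | none => rfl
          | some j => exact hxy j fun h => hj (by rw [h])
    · refine hasSubgaussianMGF_of_oscillation_le (μ none) (g := fun b => G (e (a, b)))
        (hGe.comp measurable_prodMk_left) fun x y => hc none _ _ fun j hj => ?_
      cases j with
      | none => exact absurd rfl hj
      | some j => rfl

/-- **McDiarmid's inequality**. -/
theorem measure_ge_le_of_bounded_differences {X ι : Type*} [MeasurableSpace X] [Fintype ι]
    (μ : ι → Measure X) [∀ i, IsProbabilityMeasure (μ i)] (c : ι → ℝ) (hc₀ : ∀ i, 0 ≤ c i)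
    {G : (ι → X) → ℝ} {B : ℝ} (hG : Measurable G) (hB : ∀ z, |G z| ≤ B)
    (hc : ∀ i x y, (∀ j, j ≠ i → x j = y j) → |G x - G y| ≤ c i)
    (hpos : 0 < ∑ i, c i ^ 2) {τ : ℝ} (hτ : 0 ≤ τ) :
    (Measure.pi μ).real {z | ∫ z', G z' ∂(Measure.pi μ) + √(τ / 2 * ∑ i, c i ^ 2) ≤ G z} ≤
      Real.exp (-τ) := by
  have h := (hasSubgaussianMGF_of_bounded_differences ι μ (fun i => (c i).toNNReal) G B hG hB
    (fun i x y h => (hc i x y h).trans (Real.le_coe_toNNReal _))).measure_ge_le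
      (Real.sqrt_nonneg (τ / 2 * ∑ i, c i ^ 2))
  have hset : {z | ∫ z', G z' ∂(Measure.pi μ) + √(τ / 2 * ∑ i, c i ^ 2) ≤ G z} =
      {z | √(τ / 2 * ∑ i, c i ^ 2) ≤ G z - ∫ z', G z' ∂(Measure.pi μ)} := by
    ext z; exact (le_sub_iff_add_le' (α := ℝ)).symm
  rw [hset]
  refine h.trans (le_of_eq ?_)
  -- The variance proxy is `(∑ c i ^ 2) / 4`, so the squared deviation `τ / 2 * ∑ c i ^ 2` makes the
  -- exponent exactly `-τ`.
  congr 1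
  rw [Real.sq_sqrt (by positivity)]
  push_cast
  simp only [Real.coe_toNNReal _ (hc₀ _), div_pow, ← Finset.sum_div]
  field_simp

/-! ### Symmetrization and uniform deviations of weighted sums. -/

section Symmetrization

variable {X ι κ : Type*} [Fintype ι]

/-- The supremum over `k` of the weighted sums `∑ i, v i * φ k (z i)`. -/
noncomputable def supWeightedSum (φ : κ → X → ℝ) (v : ι → ℝ) (z : ι → X) : ℝ :=
  ⨆ k, ∑ i, v i * φ k (z i)

/-- The supremum over `k` of the centered weighted sums. -/
noncomputable def supDeviation [MeasurableSpace X] (μ : ι → Measure X) (φ : κ → X → ℝ) (v : ι → ℝ)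
    (z : ι → X) : ℝ :=
  ⨆ k, (∑ i, v i * φ k (z i) - ∑ i, v i * ∫ x, φ k x ∂μ i)

/-- The average over all sign vectors of the suprema of the signed weighted sums. -/
noncomputable def signAverage [DecidableEq ι] (φ : κ → X → ℝ) (v : ι → ℝ) (z : ι → X) : ℝ :=
  (1 / 2 ^ Fintype.card ι) *
    ∑ σ : ι → ℤˣ, supWeightedSum φ (fun i => ((σ i : ℤ) : ℝ) * v i) z

lemma abs_units_int_cast (s : ℤˣ) : |((s : ℤ) : ℝ)| = 1 := by
  rcases Int.units_eq_one_or s with rfl | rfl <;> simp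

lemma card_sign_vectors [DecidableEq ι] :
    (Finset.univ : Finset (ι → ℤˣ)).card = 2 ^ Fintype.card ι := by
  rw [Finset.card_univ, Fintype.card_fun]
  rfl

lemma abs_weighted_sum_le {ν : ℝ} {g : ι → ℝ} (hg : ∀ i, |g i| ≤ ν) (v : ι → ℝ) :
    |∑ i, v i * g i| ≤ (∑ i, |v i|) * ν := by
  rw [Finset.sum_mul]
  refine (Finset.abs_sum_le_sum_abs _ _).trans (Finset.sum_le_sum fun i _ => ?_)
  rw [abs_mul]
  gcongr
  exact hg i

lemma weighted_sum_sub_le {ν : ℝ} {f : X → ℝ} (hf : ∀ x, |f x| ≤ ν) (v : ι → ℝ)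
    {i : ι} {x y : ι → X} (h : ∀ j, j ≠ i → x j = y j) :
    |∑ i, v i * f (x i) - ∑ i, v i * f (y i)| ≤ 2 * ν * |v i| := by
  rw [← Finset.sum_sub_distrib, Finset.sum_eq_single i
    (fun j _ hj => by rw [h j hj, sub_self]) (fun h => absurd (Finset.mem_univ i) h),
    ← mul_sub, abs_mul, mul_comm]
  gcongr
  exact (abs_sub _ _).trans (by linarith [hf (x i), hf (y i)])

/-- Bounded families with values at distance at most `c` have suprema at distance at most `c`. -/
lemma abs_ciSup_sub_ciSup_le [Nonempty κ] {a b : κ → ℝ} {c : ℝ}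
    (ha : BddAbove (Set.range a)) (hb : BddAbove (Set.range b)) (h : ∀ k, |a k - b k| ≤ c) :
    |(⨆ k, a k) - ⨆ k, b k| ≤ c := by
  rw [abs_sub_le_iff]
  constructor
  · rw [sub_le_iff_le_add]
    exact ciSup_le fun k => by linarith [le_ciSup hb k, (abs_le.1 (h k)).2]
  · rw [sub_le_iff_le_add]
    exact ciSup_le fun k => by linarith [le_ciSup ha k, (abs_le.1 (h k)).1]

lemma abs_ciSup_le [Nonempty κ] {a : κ → ℝ} {c : ℝ} (h : ∀ k, |a k| ≤ c) : |⨆ k, a k| ≤ c := by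
  have hb : BddAbove (Set.range a) := ⟨c, by rintro _ ⟨k, rfl⟩; exact (abs_le.1 (h k)).2⟩
  obtain ⟨k⟩ := ‹Nonempty κ›
  have : Nonempty κ := ⟨k⟩
  exact abs_le.2 ⟨(abs_le.1 (h k)).1.trans (le_ciSup hb k), ciSup_le fun k => (abs_le.1 (h k)).2⟩

lemma bddAbove_range_of_abs_le {a : κ → ℝ} {c : ℝ} (h : ∀ k, |a k| ≤ c) :
    BddAbove (Set.range a) := ⟨c, by rintro _ ⟨k, rfl⟩; exact (abs_le.1 (h k)).2⟩

lemma abs_supWeightedSum_le [Nonempty κ] {φ : κ → X → ℝ} {ν : ℝ} (hφ : ∀ k x, |φ k x| ≤ ν)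
    (v : ι → ℝ) (z : ι → X) : |supWeightedSum φ v z| ≤ (∑ i, |v i|) * ν :=
  abs_ciSup_le fun k => abs_weighted_sum_le (fun i => hφ k (z i)) v

lemma bddAbove_weighted_sum {φ : κ → X → ℝ} {ν : ℝ} (hφ : ∀ k x, |φ k x| ≤ ν)
    (v : ι → ℝ) (z : ι → X) : BddAbove (Set.range fun k => ∑ i, v i * φ k (z i)) :=
  bddAbove_range_of_abs_le fun k => abs_weighted_sum_le (fun i => hφ k (z i)) v

lemma abs_supWeightedSum_sub_le [Nonempty κ] {φ : κ → X → ℝ} {ν : ℝ} (hφ : ∀ k x, |φ k x| ≤ ν)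
    (v : ι → ℝ) {i : ι} {x y : ι → X} (h : ∀ j, j ≠ i → x j = y j) :
    |supWeightedSum φ v x - supWeightedSum φ v y| ≤ 2 * ν * |v i| :=
  abs_ciSup_sub_ciSup_le (bddAbove_weighted_sum hφ v x) (bddAbove_weighted_sum hφ v y)
    fun k => weighted_sum_sub_le (hφ k) v h

lemma measurable_weighted_sum [MeasurableSpace X] {f : X → ℝ} (hf : Measurable f) (v : ι → ℝ) :
    Measurable fun z : ι → X => ∑ i, v i * f (z i) :=
  Finset.measurable_sum _ fun i _ => (hf.comp (measurable_pi_apply i)).const_mul _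

lemma measurable_supWeightedSum [MeasurableSpace X] [Countable κ] {φ : κ → X → ℝ}
    (hm : ∀ k, Measurable (φ k)) (v : ι → ℝ) : Measurable (supWeightedSum φ v) :=
  Measurable.iSup fun k => measurable_weighted_sum (hm k) v

lemma abs_sign_mul {ι : Type*} (σ : ι → ℤˣ) (v : ι → ℝ) (i : ι) : |((σ i : ℤ) : ℝ) * v i| = |v i| := by
  rw [abs_mul, abs_units_int_cast, one_mul]

/-- An average over sign vectors is at most a uniform bound of its terms. -/
lemma abs_sign_mean_le [DecidableEq ι] {a : (ι → ℤˣ) → ℝ} {c : ℝ} (h : ∀ σ, |a σ| ≤ c) :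
    |(1 / 2 ^ Fintype.card ι) * ∑ σ : ι → ℤˣ, a σ| ≤ c := by
  have h1 : |∑ σ : ι → ℤˣ, a σ| ≤ 2 ^ Fintype.card ι * c := by
    refine (Finset.abs_sum_le_sum_abs _ _).trans ((Finset.sum_le_card_nsmul _ _ c
      fun σ _ => h σ).trans (le_of_eq ?_))
    rw [card_sign_vectors, nsmul_eq_mul]
    push_cast
    rfl
  rw [abs_mul, abs_of_pos (by positivity), one_div, inv_mul_le_iff₀ (by positivity)]
  exact h1

lemma abs_signAverage_le [DecidableEq ι] [Nonempty κ] {φ : κ → X → ℝ} {ν : ℝ}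
    (hφ : ∀ k x, |φ k x| ≤ ν) (v : ι → ℝ) (z : ι → X) :
    |signAverage φ v z| ≤ (∑ i, |v i|) * ν :=
  abs_sign_mean_le fun σ => (abs_supWeightedSum_le hφ _ z).trans_eq (by simp_rw [abs_sign_mul])

lemma abs_signAverage_sub_le [DecidableEq ι] [Nonempty κ] {φ : κ → X → ℝ} {ν : ℝ}
    (hφ : ∀ k x, |φ k x| ≤ ν) (v : ι → ℝ) {i : ι} {x y : ι → X} (h : ∀ j, j ≠ i → x j = y j) :
    |signAverage φ v x - signAverage φ v y| ≤ 2 * ν * |v i| := by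
  rw [signAverage, signAverage, ← mul_sub, ← Finset.sum_sub_distrib]
  exact abs_sign_mean_le fun σ => (abs_supWeightedSum_sub_le hφ _ h).trans_eq (by
    rw [abs_sign_mul])

lemma measurable_signAverage [DecidableEq ι] [MeasurableSpace X] [Countable κ] {φ : κ → X → ℝ}
    (hm : ∀ k, Measurable (φ k)) (v : ι → ℝ) : Measurable (signAverage φ v) :=
  (Finset.measurable_sum _ fun _ _ => measurable_supWeightedSum hm _).const_mul _

section Deviation

variable [MeasurableSpace X]

lemma abs_integral_le_of_abs_le (p : Measure X) [IsProbabilityMeasure p] {f : X → ℝ} {ν : ℝ}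
    (hf : ∀ x, |f x| ≤ ν) : |∫ x, f x ∂p| ≤ ν := by
  simpa using norm_integral_le_of_norm_le_const (μ := p) (f := f) (ae_of_all _ hf)

variable (μ : ι → Measure X)

lemma measurable_supDeviation [Countable κ] {φ : κ → X → ℝ}
    (hm : ∀ k, Measurable (φ k)) (v : ι → ℝ) : Measurable (supDeviation μ φ v) :=
  Measurable.iSup fun k => (measurable_weighted_sum (hm k) v).sub_const _

variable [∀ i, IsProbabilityMeasure (μ i)]

lemma abs_centered_sum_le {f : X → ℝ} {ν : ℝ} (hf : ∀ x, |f x| ≤ ν) (v : ι → ℝ) (z : ι → X) :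
    |∑ i, v i * f (z i) - ∑ i, v i * ∫ x, f x ∂μ i| ≤ 2 * ((∑ i, |v i|) * ν) := by
  refine (abs_sub _ _).trans ?_
  linarith [abs_weighted_sum_le (fun i => hf (z i)) v,
    abs_weighted_sum_le (fun i => abs_integral_le_of_abs_le (μ i) hf) v]

lemma bddAbove_centered_sum {φ : κ → X → ℝ} {ν : ℝ} (hφ : ∀ k x, |φ k x| ≤ ν) (v : ι → ℝ)
    (z : ι → X) :
    BddAbove (Set.range fun k => ∑ i, v i * φ k (z i) - ∑ i, v i * ∫ x, φ k x ∂μ i) :=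
  bddAbove_range_of_abs_le fun k => abs_centered_sum_le μ (hφ k) v z

lemma abs_supDeviation_le [Nonempty κ] {φ : κ → X → ℝ} {ν : ℝ} (hφ : ∀ k x, |φ k x| ≤ ν)
    (v : ι → ℝ) (z : ι → X) : |supDeviation μ φ v z| ≤ 2 * ((∑ i, |v i|) * ν) :=
  abs_ciSup_le fun k => abs_centered_sum_le μ (hφ k) v z

lemma abs_supDeviation_sub_le [Nonempty κ] {φ : κ → X → ℝ} {ν : ℝ} (hφ : ∀ k x, |φ k x| ≤ ν)
    (v : ι → ℝ) {i : ι} {x y : ι → X} (h : ∀ j, j ≠ i → x j = y j) :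
    |supDeviation μ φ v x - supDeviation μ φ v y| ≤ 2 * ν * |v i| := by
  refine abs_ciSup_sub_ciSup_le (bddAbove_centered_sum μ hφ v x) (bddAbove_centered_sum μ hφ v y)
    fun k => ?_
  rw [sub_sub_sub_cancel_right]
  exact weighted_sum_sub_le (hφ k) v h

/-- The mean of a weighted sum of functions of independent variables. -/
lemma integral_weighted_sum {f : X → ℝ} (hm : Measurable f) {ν : ℝ} (hf : ∀ x, |f x| ≤ ν)
    (v : ι → ℝ) : ∫ z, ∑ i, v i * f (z i) ∂(Measure.pi μ) = ∑ i, v i * ∫ x, f x ∂μ i := by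
  rw [integral_finsetSum]
  · refine Finset.sum_congr rfl fun i _ => ?_
    rw [integral_const_mul]
    congr 1
    rw [← (measurePreserving_eval μ i).map_eq, integral_map (measurable_pi_apply i).aemeasurable
      hm.aestronglyMeasurable]
  · exact fun i _ => Integrable.const_mul (Integrable.of_bound
      (hm.comp (measurable_pi_apply i)).aestronglyMeasurable ν (ae_of_all _ fun z => hf _)) _

/-- Exchange of the coordinates of two samples at the places where the sign is negative. -/
def swapSamples (σ : ι → ℤˣ) (z : (ι → X) × (ι → X)) : (ι → X) × (ι → X) :=
  (fun i => if σ i = 1 then z.1 i else z.2 i, fun i => if σ i = 1 then z.2 i else z.1 i)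

lemma measurePreserving_swapSamples (σ : ι → ℤˣ) :
    MeasurePreserving (swapSamples σ) ((Measure.pi μ).prod (Measure.pi μ))
      ((Measure.pi μ).prod (Measure.pi μ)) := by
  -- Regrouped as a family of pairs, the exchange acts coordinatewise, and each `μ i × μ i` is
  -- invariant under it.
  have h1 := measurePreserving_arrowProdEquivProdArrow X X ι μ μ
  have h2 : MeasurePreserving (fun (a : ι → X × X) i => (if σ i = 1 then id else Prod.swap) (a i))
      (Measure.pi fun i => (μ i).prod (μ i)) (Measure.pi fun i => (μ i).prod (μ i)) :=
    measurePreserving_pi _ _ fun i => by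
      split_ifs
      · exact MeasurePreserving.id _
      · exact Measure.measurePreserving_swap
  have h3 := (h1.comp h2).comp h1.symm
  convert h3 using 1
  ext z i
  · change _ = ((if σ i = 1 then (id : X × X → X × X) else Prod.swap) (z.1 i, z.2 i)).1
    simp only [swapSamples]
    split_ifs <;> rfl
  · change _ = ((if σ i = 1 then (id : X × X → X × X) else Prod.swap) (z.1 i, z.2 i)).2
    simp only [swapSamples]
    split_ifs <;> rfl

/-- **Symmetrization**: the mean of the largest deviation is at most twice the mean of the
Rademacher average. -/
theorem integral_supDeviation_le [DecidableEq ι] [Countable κ] [Nonempty κ] {φ : κ → X → ℝ} {ν : ℝ}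
    (hm : ∀ k, Measurable (φ k)) (hφ : ∀ k x, |φ k x| ≤ ν) (v : ι → ℝ) :
    ∫ z, supDeviation μ φ v z ∂(Measure.pi μ) ≤
      2 * ∫ z, signAverage φ v z ∂(Measure.pi μ) := by
  set π := Measure.pi μ
  let D : (ι → ℝ) → (ι → X) × (ι → X) → ℝ := fun u z =>
    ⨆ k, (∑ i, u i * φ k (z.1 i) - ∑ i, u i * φ k (z.2 i))
  have hDb : ∀ (u : ι → ℝ) (z : (ι → X) × (ι → X)) k, |∑ i, u i * φ k (z.1 i) - ∑ i, u i * φ k (z.2 i)| ≤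
      2 * ((∑ i, |u i|) * ν) := fun u z k => (abs_sub _ _).trans (by
    linarith [abs_weighted_sum_le (fun i => hφ k (z.1 i)) u,
      abs_weighted_sum_le (fun i => hφ k (z.2 i)) u])
  have hDm : ∀ u, Measurable (D u) := fun u => Measurable.iSup fun k =>
    ((measurable_weighted_sum (hm k) u).comp measurable_fst).sub
      ((measurable_weighted_sum (hm k) u).comp measurable_snd)
  have hDi : ∀ u, Integrable (D u) (π.prod π) := fun u =>
    Integrable.of_bound (hDm u).aestronglyMeasurable _ (ae_of_all _ fun z => abs_ciSup_le (hDb u z))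
  have hDi' : ∀ u z, Integrable (fun z' => D u (z, z')) π := fun u z =>
    Integrable.of_bound ((hDm u).comp measurable_prodMk_left).aestronglyMeasurable _
      (ae_of_all _ fun z' => abs_ciSup_le (hDb u (z, z')))
  have hwi : ∀ (u : ι → ℝ) k, Integrable (fun z : ι → X => ∑ i, u i * φ k (z i)) π := fun u k =>
    Integrable.of_bound (measurable_weighted_sum (hm k) u).aestronglyMeasurable _
      (ae_of_all _ fun z => abs_weighted_sum_le (fun i => hφ k (z i)) u)
  have hSi : ∀ u, Integrable (supWeightedSum φ u) π := fun u =>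
    Integrable.of_bound (measurable_supWeightedSum hm u).aestronglyMeasurable _
      (ae_of_all _ fun z => abs_supWeightedSum_le hφ u z)
  have hdi : Integrable (supDeviation μ φ v) π :=
    Integrable.of_bound (measurable_supDeviation μ hm v).aestronglyMeasurable _
      (ae_of_all _ fun z => abs_supDeviation_le μ hφ v z)
  -- Ghost sample: the means are averages over an independent copy, and a supremum of integrals is
  -- at most the integral of the supremum.
  have hghost : ∀ z, supDeviation μ φ v z ≤ ∫ z', D v (z, z') ∂π := fun z => ciSup_le fun k => by
    calc ∑ i, v i * φ k (z i) - ∑ i, v i * ∫ x, φ k x ∂μ i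
        = ∫ z', (∑ i, v i * φ k (z i) - ∑ i, v i * φ k (z' i)) ∂π := by
          rw [integral_sub (integrable_const _) (hwi v k), integral_weighted_sum μ (hm k) (hφ k)]
          simp
      _ ≤ _ := integral_mono ((integrable_const _).sub (hwi v k)) (hDi' v z) fun z' =>
          le_ciSup (bddAbove_range_of_abs_le (hDb v (z, z'))) k
  -- Exchanging the two samples at `i` flips the sign of the `i`-th difference.
  have hswap : ∀ σ : ι → ℤˣ, ∫ z, D v z ∂(π.prod π) =
      ∫ z, D (fun i => ((σ i : ℤ) : ℝ) * v i) z ∂(π.prod π) := fun σ => by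
    have hT := measurePreserving_swapSamples μ σ
    conv_lhs => rw [← hT.map_eq]
    rw [integral_map hT.measurable.aemeasurable (hDm v).aestronglyMeasurable]
    congr 1 with z
    refine iSup_congr fun k => ?_
    rw [← Finset.sum_sub_distrib, ← Finset.sum_sub_distrib]
    refine Finset.sum_congr rfl fun i _ => ?_
    rcases Int.units_eq_one_or (σ i) with h | h <;> simp [swapSamples, h]
    ring
  have hsplit : ∀ u, ∫ z, D u z ∂(π.prod π) ≤
      ∫ z, supWeightedSum φ u z ∂π + ∫ z, supWeightedSum φ (fun i => -u i) z ∂π := fun u => by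
    have e1 : Integrable (fun z : (ι → X) × (ι → X) => supWeightedSum φ u z.1) (π.prod π) :=
      (hSi u).comp_fst π
    have e2 : Integrable (fun z : (ι → X) × (ι → X) => supWeightedSum φ (fun i => -u i) z.2)
      (π.prod π) := (hSi fun i => -u i).comp_snd π
    calc ∫ z, D u z ∂(π.prod π)
        ≤ ∫ z, (supWeightedSum φ u z.1 + supWeightedSum φ (fun i => -u i) z.2) ∂(π.prod π) := by
          refine integral_mono (hDi u) (e1.add e2) fun z => ciSup_le fun k => ?_
          have a1 := le_ciSup (bddAbove_weighted_sum hφ u z.1) k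
          have a2 := le_ciSup (bddAbove_weighted_sum hφ (fun i => -u i) z.2) k
          simp only [neg_mul, Finset.sum_neg_distrib] at a2
          simp only [supWeightedSum, neg_mul, Finset.sum_neg_distrib]
          linarith
      _ = _ := by
          rw [integral_add e1 e2, integral_fun_fst, integral_fun_snd]
          simp
  have hsum : ∫ z, signAverage φ v z ∂π = (1 / 2 ^ Fintype.card ι) *
      ∑ σ : ι → ℤˣ, ∫ z, supWeightedSum φ (fun i => ((σ i : ℤ) : ℝ) * v i) z ∂π := by
    simp only [signAverage]
    rw [integral_const_mul, integral_finsetSum _ fun σ _ => hSi _]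
  -- `σ ↦ -σ` permutes the sign vectors, so both halves of `hsplit` have the same average; hence the
  -- factor `2`.
  have hneg : ∑ σ : ι → ℤˣ, ∫ z, supWeightedSum φ (fun i => -(((σ i : ℤ) : ℝ) * v i)) z ∂π =
      ∑ σ : ι → ℤˣ, ∫ z, supWeightedSum φ (fun i => ((σ i : ℤ) : ℝ) * v i) z ∂π := by
    exact Fintype.sum_equiv (Equiv.neg (ι → ℤˣ)) _ _ fun σ => by simp
  have hD : ∫ z, D v z ∂(π.prod π) ≤ 2 * ∫ z, signAverage φ v z ∂π := by
    have h2 : (2 ^ Fintype.card ι : ℝ) * ∫ z, D v z ∂(π.prod π) ≤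
        2 * ∑ σ : ι → ℤˣ, ∫ z, supWeightedSum φ (fun i => ((σ i : ℤ) : ℝ) * v i) z ∂π := by
      calc (2 ^ Fintype.card ι : ℝ) * ∫ z, D v z ∂(π.prod π)
          = ∑ σ : ι → ℤˣ, ∫ z, D (fun i => ((σ i : ℤ) : ℝ) * v i) z ∂(π.prod π) := by
            simp_rw [← hswap, Finset.sum_const, card_sign_vectors, nsmul_eq_mul]
            push_cast
            rfl
        _ ≤ _ := (Finset.sum_le_sum fun σ _ => hsplit _).trans_eq (by
            rw [Finset.sum_add_distrib, hneg, two_mul])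
    rw [hsum, ← mul_assoc, mul_one_div, div_mul_eq_mul_div, le_div_iff₀ (by positivity), mul_comm]
    exact h2
  calc ∫ z, supDeviation μ φ v z ∂π ≤ ∫ z, ∫ z', D v (z, z') ∂π ∂π :=
        integral_mono hdi (hDi v).integral_prod_left hghost
    _ = ∫ z, D v z ∂(π.prod π) := (integral_prod _ (hDi v)).symm
    _ ≤ _ := hD

/-- With high probability the largest deviation is at most twice the Rademacher average plus a
term of the order of the Euclidean norm of the weights. -/
theorem measure_supDeviation_ge_le [DecidableEq ι] [Countable κ] [Nonempty κ] {φ : κ → X → ℝ}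
    {ν : ℝ} (hm : ∀ k, Measurable (φ k)) (hφ : ∀ k x, |φ k x| ≤ ν) (hν : 0 < ν) {v : ι → ℝ}
    (hv : 0 < ∑ i, v i ^ 2) {τ : ℝ} (hτ : 0 ≤ τ) :
    (Measure.pi μ).real {z | √(18 * τ * ν ^ 2 * ∑ i, v i ^ 2) ≤
      supDeviation μ φ v z - 2 * signAverage φ v z} ≤ Real.exp (-τ) := by
  -- One coordinate moves the supremum by `2ν|v i|` and twice the sign average by `4ν|v i|`. With
  -- the `τ / 2` of McDiarmid, `36` becomes `18`.
  have hsq : ∑ i, (6 * ν * |v i|) ^ 2 = 36 * ν ^ 2 * ∑ i, v i ^ 2 := by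
    simp_rw [mul_pow, sq_abs, Finset.mul_sum]
    norm_num
  have hmG : Measurable fun z => supDeviation μ φ v z - 2 * signAverage φ v z :=
    (measurable_supDeviation μ hm v).sub ((measurable_signAverage hm v).const_mul 2)
  have h := measure_ge_le_of_bounded_differences μ (fun i => 6 * ν * |v i|)
    (fun i => by positivity) (B := 4 * ((∑ i, |v i|) * ν)) hmG
    (fun z => abs_le.2 (by
      have h1 := abs_le.1 (abs_supDeviation_le μ hφ v z)
      have h2 := abs_le.1 (abs_signAverage_le hφ v z)
      constructor <;> linarith))
    (fun i x y hxy => abs_le.2 (by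
      have h1 := abs_le.1 (abs_supDeviation_sub_le μ hφ v hxy)
      have h2 := abs_le.1 (abs_signAverage_sub_le hφ v hxy)
      constructor <;> linarith)) (by rw [hsq]; positivity) hτ
  have hE : ∫ z, (supDeviation μ φ v z - 2 * signAverage φ v z) ∂(Measure.pi μ) ≤ 0 := by
    rw [integral_sub, integral_const_mul]
    · linarith [integral_supDeviation_le μ hm hφ v]
    · exact Integrable.of_bound (measurable_supDeviation μ hm v).aestronglyMeasurable _
        (ae_of_all _ fun z => abs_supDeviation_le μ hφ v z)
    · exact (Integrable.of_bound (measurable_signAverage hm v).aestronglyMeasurable _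
        (ae_of_all _ fun z => abs_signAverage_le hφ v z)).const_mul 2
  refine (measureReal_mono fun z hz => ?_).trans h
  rw [hsq, show τ / 2 * (36 * ν ^ 2 * ∑ i, v i ^ 2) = 18 * τ * ν ^ 2 * ∑ i, v i ^ 2 by ring]
  exact (add_le_of_nonpos_left hE).trans hz

/-- **Hoeffding's inequality** for a weighted sum of values of a bounded function. -/
theorem measure_weighted_sum_ge_le {f : X → ℝ} (hm : Measurable f) {ν : ℝ} (hf : ∀ x, |f x| ≤ ν)
    (hν : 0 < ν) {v : ι → ℝ} (hv : 0 < ∑ i, v i ^ 2) {τ : ℝ} (hτ : 0 ≤ τ) :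
    (Measure.pi μ).real {z | ∑ i, v i * ∫ x, f x ∂μ i + √(2 * τ * ν ^ 2 * ∑ i, v i ^ 2) ≤
      ∑ i, v i * f (z i)} ≤ Real.exp (-τ) := by
  have hsq : ∑ i, (2 * ν * |v i|) ^ 2 = 4 * ν ^ 2 * ∑ i, v i ^ 2 := by
    simp_rw [mul_pow, sq_abs, Finset.mul_sum]
    norm_num
  have h := measure_ge_le_of_bounded_differences μ (fun i => 2 * ν * |v i|)
    (fun i => by positivity) (measurable_weighted_sum hm v)
    (fun z => abs_weighted_sum_le (fun i => hf (z i)) v)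
    (fun i x y hxy => weighted_sum_sub_le hf v hxy) (by rw [hsq]; positivity) hτ
  rwa [hsq, integral_weighted_sum μ hm hf,
    show τ / 2 * (4 * ν ^ 2 * ∑ i, v i ^ 2) = 2 * τ * ν ^ 2 * ∑ i, v i ^ 2 by ring] at h

end Deviation

end Symmetrization

/-! ### Population geometry: densities, the distance and the optimal critic. -/

namespace FisherIPM

section PopulationFacts

variable {X : Type*} [MeasurableSpace X] (P Q : Measure X)

lemma add_eq_two_smul_mixture : P + Q = (2 : ℝ≥0) • mixture P Q := by
  ext s _
  simp only [mixture, Measure.smul_apply, smul_eq_mul, ENNReal.smul_def]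
  rw [← mul_assoc]
  simp [ENNReal.mul_inv_cancel]

lemma absolutelyContinuous_mixture_left : P ≪ mixture P Q := by
  have h : P ≪ P + Q := (Measure.le_add_right le_rfl).absolutelyContinuous
  exact h.trans (Measure.absolutelyContinuous_smul (by simp))

lemma mixture_comm : mixture P Q = mixture Q P := by
  rw [mixture, mixture, add_comm]

lemma absolutelyContinuous_mixture_right : Q ≪ mixture P Q :=
  mixture_comm Q P ▸ absolutelyContinuous_mixture_left Q P

lemma integral_mixture {f : X → ℝ} (hP : Integrable f P) (hQ : Integrable f Q) :
    ∫ x, f x ∂(mixture P Q) = (1 / 2) * (∫ x, f x ∂P + ∫ x, f x ∂Q) := by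
  rw [mixture, integral_smul_measure, integral_add_measure hP hQ]
  simp

lemma measurable_densityDiff : Measurable (densityDiff P Q) :=
  (Measure.measurable_rnDeriv _ _).ennreal_toReal.sub
    (Measure.measurable_rnDeriv _ _).ennreal_toReal

lemma l2Norm_sq (f : X → ℝ) : l2Norm P f ^ 2 = ∫ x, f x ^ 2 ∂P :=
  Real.sq_sqrt (integral_nonneg fun _ => sq_nonneg _)

variable [IsProbabilityMeasure P] [IsProbabilityMeasure Q]

instance isProbabilityMeasure_mixture : IsProbabilityMeasure (mixture P Q) := by
  constructor
  simp only [mixture, Measure.smul_apply, Measure.add_apply, measure_univ, smul_eq_mul]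
  rw [one_add_one_eq_two, ENNReal.inv_mul_cancel two_ne_zero ENNReal.ofNat_ne_top]

/-- The densities with respect to the mixture add up to two. -/
lemma rnDeriv_add_rnDeriv_mixture :
    ∀ᵐ x ∂(mixture P Q), P.rnDeriv (mixture P Q) x + Q.rnDeriv (mixture P Q) x = 2 := by
  have h1 := Measure.rnDeriv_add P Q (mixture P Q)
  have h2 := Measure.rnDeriv_smul_left (mixture P Q) (mixture P Q) 2
  have h3 := Measure.rnDeriv_self (mixture P Q)
  rw [← add_eq_two_smul_mixture] at h2
  filter_upwards [h1, h2, h3] with x h1 h2 h3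
  rw [h1] at h2
  simpa [h3, ENNReal.smul_def] using h2

/-- Two nonnegative numbers with sum `2` differ by at most `2`. This boundedness supplies the
integrability used below. -/
lemma abs_densityDiff_le : ∀ᵐ x ∂(mixture P Q), |densityDiff P Q x| ≤ 2 := by
  filter_upwards [rnDeriv_add_rnDeriv_mixture P Q] with x hx
  have hP : P.rnDeriv (mixture P Q) x ≠ ⊤ := fun h => by simp [h] at hx
  have hQ : Q.rnDeriv (mixture P Q) x ≠ ⊤ := fun h => by simp [h] at hx
  have h := congrArg ENNReal.toReal hx
  rw [ENNReal.toReal_add hP hQ] at h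
  norm_num at h
  rw [densityDiff, abs_le]
  have a := ENNReal.toReal_nonneg (a := P.rnDeriv (mixture P Q) x)
  have b := ENNReal.toReal_nonneg (a := Q.rnDeriv (mixture P Q) x)
  constructor <;> linarith

lemma integrable_mul_densityDiff {f : X → ℝ} (hm : Measurable f) {B : ℝ}
    (hf : ∀ᵐ x ∂(mixture P Q), |f x| ≤ B) :
    Integrable (fun x => f x * densityDiff P Q x) (mixture P Q) := by
  refine Integrable.of_bound (hm.mul (measurable_densityDiff P Q)).aestronglyMeasurable (B * 2) ?_
  filter_upwards [hf, abs_densityDiff_le P Q] with x h1 h2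
  rw [Real.norm_eq_abs, abs_mul]
  have : 0 ≤ B := (abs_nonneg _).trans h1
  gcongr

/-- Change of measure; it exhibits the discrepancy as an `L₂` inner product, maximized over the
sphere in the direction of the density difference. -/
lemma meanDiscrepancy_eq_integral {f : X → ℝ} (hm : Measurable f) {B : ℝ} (hf : ∀ x, |f x| ≤ B) :
    meanDiscrepancy P Q f = ∫ x, f x * densityDiff P Q x ∂(mixture P Q) := by
  have hi : ∀ R : Measure X, IsProbabilityMeasure R → R ≪ mixture P Q →
      Integrable (fun x => f x * (R.rnDeriv (mixture P Q) x).toReal) (mixture P Q) := by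
    intro R _ hR
    have := (integrable_rnDeriv_smul_iff hR (f := f)).2
      (Integrable.of_bound hm.aestronglyMeasurable B (ae_of_all _ hf))
    simpa [mul_comm] using this
  have hP := absolutelyContinuous_mixture_left P Q
  have hQ := absolutelyContinuous_mixture_right P Q
  simp only [meanDiscrepancy, densityDiff, mul_sub]
  rw [integral_sub (hi P ‹_› hP) (hi Q ‹_› hQ), ← integral_rnDeriv_smul hP,
    ← integral_rnDeriv_smul hQ]
  simp [mul_comm]

/-- If the norm vanished, the densities would agree almost everywhere, and absolute continuity
recovers each measure from its density. -/
lemma chi2_pos (h : P ≠ Q) : 0 < chi2 P Q := by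
  refine lt_of_le_of_ne (Real.sqrt_nonneg _) fun h0 => h ?_
  have hd := l2Norm_sq (mixture P Q) (densityDiff P Q)
  rw [show l2Norm (mixture P Q) (densityDiff P Q) = 0 from h0.symm] at hd
  have hi := integrable_mul_densityDiff P Q (measurable_densityDiff P Q) (abs_densityDiff_le P Q)
  simp_rw [← pow_two] at hi
  have hz := (integral_eq_zero_iff_of_nonneg (fun x => sq_nonneg (densityDiff P Q x)) hi).1
    (by simpa using hd.symm)
  refine (Measure.withDensity_rnDeriv_eq P _ (absolutelyContinuous_mixture_left P Q)).symm.trans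
    (Eq.trans (withDensity_congr_ae ?_)
      (Measure.withDensity_rnDeriv_eq Q _ (absolutelyContinuous_mixture_right P Q)))
  filter_upwards [hz, rnDeriv_add_rnDeriv_mixture P Q] with x h1 h2
  have hP : P.rnDeriv (mixture P Q) x ≠ ⊤ := fun h => by simp [h] at h2
  have hQ : Q.rnDeriv (mixture P Q) x ≠ ⊤ := fun h => by simp [h] at h2
  rw [← ENNReal.toReal_eq_toReal_iff' hP hQ]
  exact sub_eq_zero.1 (pow_eq_zero_iff two_ne_zero |>.1 h1)

/-- On the unit sphere, half the squared distance to the optimal critic is the relative loss of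
the mean discrepancy. -/
lemma half_sq_l2Norm_sub_optimalCritic (h : P ≠ Q) {f : X → ℝ} (hm : Measurable f) {B : ℝ}
    (hf : ∀ x, |f x| ≤ B) (h1 : l2Norm (mixture P Q) f = 1) :
    (1 / 2) * l2Norm (mixture P Q) (fun x => f x - optimalCritic P Q x) ^ 2 =
      (chi2 P Q - meanDiscrepancy P Q f) / chi2 P Q := by
  have hχ := chi2_pos P Q h
  have hd := l2Norm_sq (mixture P Q) (densityDiff P Q)
  have hf2 := l2Norm_sq (mixture P Q) f
  have hi := integrable_mul_densityDiff P Q (measurable_densityDiff P Q) (abs_densityDiff_le P Q)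
  simp_rw [← pow_two] at hi
  have hfd := integrable_mul_densityDiff P Q hm (ae_of_all _ hf)
  have hff : Integrable (fun x => f x ^ 2) (mixture P Q) :=
    Integrable.of_bound (hm.pow_const 2).aestronglyMeasurable (B ^ 2) (ae_of_all _ fun x => by
      rw [Real.norm_eq_abs, abs_pow]; gcongr; exact hf x)
  rw [h1, one_pow] at hf2
  change chi2 P Q ^ 2 = _ at hd
  -- Both `f` and the optimal critic have norm one, so the squared distance is `2 - 2 𝓔(f) / χ₂`.
  have hexp : ∀ x, (f x - optimalCritic P Q x) ^ 2 = f x ^ 2 -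
      2 / chi2 P Q * (f x * densityDiff P Q x) + (1 / chi2 P Q) ^ 2 * densityDiff P Q x ^ 2 := by
    intro x; rw [optimalCritic]; ring
  have hsub : Integrable (fun x => f x ^ 2 - 2 / chi2 P Q * (f x * densityDiff P Q x))
    (mixture P Q) := hff.sub (hfd.const_mul _)
  rw [l2Norm_sq]
  simp_rw [hexp]
  rw [integral_add hsub (hi.const_mul _), integral_sub hff (hfd.const_mul _),
    integral_const_mul, integral_const_mul, ← hd, ← hf2, ← meanDiscrepancy_eq_integral P Q hm hf]
  field_simp
  ring

/-- Some member of the class on the unit sphere nearly attains the approximation error. -/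
lemma exists_relative_loss_lt (h : P ≠ Q) {H : Set (X → ℝ)} (hm : ∀ f ∈ H, Measurable f) {B : ℝ}
    (hB : ∀ f ∈ H, ∀ x, |f x| ≤ B) (hne : (H ∩ unitSphere P Q).Nonempty) {δ : ℝ} (hδ : 0 < δ) :
    ∃ f ∈ H, l2Norm (mixture P Q) f = 1 ∧
      (chi2 P Q - meanDiscrepancy P Q f) / chi2 P Q < approximationError P Q H + δ := by
  have := hne.to_subtype
  -- The infimum need not be attained; the slack `2 * δ` is halved by the factor `1 / 2`.
  obtain ⟨⟨f, hfH, hf1⟩, hlt⟩ := exists_lt_of_ciInf_lt (lt_add_of_pos_right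
    (⨅ f : ↥(H ∩ unitSphere P Q),
      l2Norm (mixture P Q) (fun x => f.1 x - optimalCritic P Q x) ^ 2) (mul_pos two_pos hδ))
  refine ⟨f, hfH, hf1, ?_⟩
  rw [← half_sq_l2Norm_sub_optimalCritic P Q h (hm f hfH) (hB f hfH) hf1, approximationError]
  linarith

end PopulationFacts

end FisherIPM

/-! ### Empirical quantities as weighted sums over the pooled sample. -/

namespace FisherIPM

section Sample

variable {X : Type*} {N M : ℕ}

/-- The laws of the members of the pooled sample. -/
def pooledLaw [MeasurableSpace X] (P Q : Measure X) (N M : ℕ) : Fin N ⊕ Fin M → Measure X :=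
  Sum.elim (fun _ => P) (fun _ => Q)

instance [MeasurableSpace X] (P Q : Measure X) [IsProbabilityMeasure P] [IsProbabilityMeasure Q]
    (i : Fin N ⊕ Fin M) : IsProbabilityMeasure (pooledLaw P Q N M i) := by
  cases i <;> simp only [pooledLaw, Sum.elim_inl, Sum.elim_inr] <;> infer_instance

lemma measurePreserving_pooled [MeasurableSpace X] (P Q : Measure X) [IsProbabilityMeasure P]
    [IsProbabilityMeasure Q] :
    MeasurePreserving (pooled (X := X)) (sampleLaw P Q N M) (Measure.pi (pooledLaw P Q N M)) := by
  have h := measurePreserving_sumPiEquivProdPi_symm (X := fun _ => X) (pooledLaw P Q N M)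
  have h' : ⇑(MeasurableEquiv.sumPiEquivProdPi fun _ : Fin N ⊕ Fin M => X).symm = pooled := by
    ext S i
    cases i <;> rfl
  rwa [h'] at h

lemma empMeanDiscrepancy_eq (S : (Fin N → X) × (Fin M → X)) (f : X → ℝ) :
    empMeanDiscrepancy S f = ∑ i, weight N M i * f (pooled S i) := by
  simp only [empMeanDiscrepancy, Fintype.sum_sum_type, weight, pooled, Sum.elim_inl, Sum.elim_inr,
    ← Finset.mul_sum]
  ring

lemma empOmega_eq (S : (Fin N → X) × (Fin M → X)) (f : X → ℝ) :
    empOmega S f = ∑ i, |weight N M i| / 2 * f (pooled S i) ^ 2 := by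
  simp only [empOmega, Fintype.sum_sum_type, weight, pooled, Sum.elim_inl, Sum.elim_inr,
    ← Finset.mul_sum, abs_div, abs_neg, abs_one, Nat.abs_cast, div_div, mul_comm (2 : ℝ)]

lemma meanDiscrepancy_eq_sum [MeasurableSpace X] (P Q : Measure X) (hN : 0 < N) (hM : 0 < M)
    (f : X → ℝ) :
    meanDiscrepancy P Q f = ∑ i, weight N M i * ∫ x, f x ∂(pooledLaw P Q N M i) := by
  simp only [meanDiscrepancy, Fintype.sum_sum_type, weight, pooledLaw, Sum.elim_inl, Sum.elim_inr,
    Finset.sum_const, Finset.card_univ, Fintype.card_fin, nsmul_eq_mul]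
  field_simp
  ring

lemma sum_half_abs_weight_mul_integral [MeasurableSpace X] (P Q : Measure X) (hN : 0 < N)
    (hM : 0 < M) {f : X → ℝ} (hP : Integrable f P) (hQ : Integrable f Q) :
    ∑ i, |weight N M i| / 2 * ∫ x, f x ∂(pooledLaw P Q N M i) = ∫ x, f x ∂(mixture P Q) := by
  rw [integral_mixture P Q hP hQ]
  simp only [Fintype.sum_sum_type, weight, pooledLaw, Sum.elim_inl, Sum.elim_inr,
    Finset.sum_const, Finset.card_univ, Fintype.card_fin, nsmul_eq_mul, abs_div, abs_neg, abs_one,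
    Nat.abs_cast]
  field_simp

lemma effectiveSize_pos (hN : 0 < N) (hM : 0 < M) : 0 < effectiveSize N M := by
  rw [effectiveSize]; positivity

/-- `1/N + 1/M = 1/n`: this is how the effective size enters the concentration bounds. -/
lemma sum_weight_sq (hN : 0 < N) (hM : 0 < M) :
    ∑ i, weight N M i ^ 2 = 1 / effectiveSize N M := by
  simp only [Fintype.sum_sum_type, weight, effectiveSize, Sum.elim_inl, Sum.elim_inr,
    Finset.sum_const, Finset.card_univ, Fintype.card_fin, nsmul_eq_mul]
  field_simp

lemma rademacher_eq_signAverage (F : Set (X → ℝ)) (S : (Fin N → X) × (Fin M → X)) :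
    rademacher F S = signAverage (fun f : F => f.1) (weight N M) (pooled S) := by
  simp [rademacher, signAverage, supWeightedSum]

lemma rademacher_mono {F G : Set (X → ℝ)} (hFG : F ⊆ G) (hF : F.Nonempty) {ν : ℝ}
    (hG : ∀ f ∈ G, ∀ x, |f x| ≤ ν) (S : (Fin N → X) × (Fin M → X)) :
    rademacher F S ≤ rademacher G S := by
  -- Nonemptiness matters for the termwise comparison: a real supremum over the empty family is `0`,
  -- which may exceed the one over `G` for a given `σ`.
  have := hF.to_subtype
  rw [rademacher_eq_signAverage, rademacher_eq_signAverage, signAverage, signAverage]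
  gcongr with σ
  exact ciSup_le fun f => le_ciSup (bddAbove_weighted_sum (φ := fun f : G => f.1)
    (fun f => hG f.1 f.2) (fun i => ((σ i : ℤ) : ℝ) * weight N M i) (pooled S)) ⟨f.1, hFG f.2⟩

/-- A nonempty class contains a singleton, whose signed sums cancel in pairs under `σ ↦ -σ`. -/
lemma rademacher_nonneg {F : Set (X → ℝ)} {ν : ℝ} (hF : ∀ f ∈ F, ∀ x, |f x| ≤ ν)
    (S : (Fin N → X) × (Fin M → X)) : 0 ≤ rademacher F S := by
  rcases F.eq_empty_or_nonempty with rfl | hne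
  · simp [rademacher]
  obtain ⟨f, hf⟩ := hne
  refine le_trans ?_ (rademacher_mono (Set.singleton_subset_iff.2 hf) ⟨f, rfl⟩ hF S)
  rw [rademacher]
  refine mul_nonneg (by positivity) (le_of_eq ?_)
  simp only [ciSup_unique, Set.default_coe_singleton]
  have h : ∀ a : (Fin N ⊕ Fin M → ℤˣ) → ℝ, (∀ σ, a (-σ) = -a σ) → 0 = ∑ σ, a σ := fun a ha => by
    have : ∑ σ, a σ = ∑ σ, -a σ :=
      (Fintype.sum_equiv (Equiv.neg _) _ _ fun σ => by simp [ha]).symm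
    rw [Finset.sum_neg_distrib] at this
    linarith
  exact h _ fun σ => by simp

lemma empOmega_le_sq (hN : 0 < N) (hM : 0 < M) {f : X → ℝ} {ν : ℝ} (hf : ∀ x, |f x| ≤ ν)
    (S : (Fin N → X) × (Fin M → X)) : empOmega S f ≤ ν ^ 2 := by
  have h2 : ∀ x, f x ^ 2 ≤ ν ^ 2 := fun x => sq_le_sq' (abs_le.1 (hf x)).1 (abs_le.1 (hf x)).2
  have h3 : ∑ i, f (S.1 i) ^ 2 ≤ N * ν ^ 2 := by
    simpa using Finset.sum_le_sum (s := Finset.univ) fun i _ => h2 (S.1 i)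
  have h4 : ∑ i, f (S.2 i) ^ 2 ≤ M * ν ^ 2 := by
    simpa using Finset.sum_le_sum (s := Finset.univ) fun i _ => h2 (S.2 i)
  calc empOmega S f ≤ 1 / (2 * N) * (N * ν ^ 2) + 1 / (2 * M) * (M * ν ^ 2) := by
        rw [empOmega]; gcongr
    _ = ν ^ 2 := by field_simp; ring

/-- Sublevels of the empirical second order moment above the squared uniform bound are the whole
class. -/
lemma empSublevel_eq_self (hN : 0 < N) (hM : 0 < M) {H : Set (X → ℝ)} {ν : ℝ}
    (hH : ∀ f ∈ H, ∀ x, |f x| ≤ ν) (S : (Fin N → X) × (Fin M → X)) {r : ℝ} (hr : ν ^ 2 ≤ r) :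
    empSublevel H S r = H :=
  Set.Subset.antisymm (fun _ hf => hf.1) fun f hf =>
    ⟨hf, (empOmega_le_sq hN hM (hH f hf) S).trans hr⟩

/-- The deviation of a pointwise limit is at most the supremum of the deviations. -/
lemma empMeanDiscrepancy_sub_le_supDeviation [MeasurableSpace X] (P Q : Measure X)
    [IsProbabilityMeasure P] [IsProbabilityMeasure Q] (hN : 0 < N) (hM : 0 < M)
    {H₀ : Set (X → ℝ)} {ν : ℝ} (hm : ∀ f ∈ H₀, Measurable f) (hH : ∀ f ∈ H₀, ∀ x, |f x| ≤ ν)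
    {f : X → ℝ} {u : ℕ → X → ℝ} (hu : ∀ k, u k ∈ H₀)
    (hlim : ∀ x, Tendsto (fun k => u k x) atTop (𝓝 (f x))) (S : (Fin N → X) × (Fin M → X)) :
    empMeanDiscrepancy S f - meanDiscrepancy P Q f ≤
      supDeviation (pooledLaw P Q N M) (fun f : H₀ => f.1) (weight N M) (pooled S) := by
  -- Dominated convergence, with the constant `ν` as dominating function.
  have hint : ∀ ρ : Measure X, IsProbabilityMeasure ρ →
      Tendsto (fun k => ∫ x, u k x ∂ρ) atTop (𝓝 (∫ x, f x ∂ρ)) := fun ρ _ =>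
    tendsto_integral_of_dominated_convergence (fun _ => ν)
      (fun k => (hm _ (hu k)).aestronglyMeasurable) (integrable_const ν)
      (fun k => ae_of_all _ (hH _ (hu k))) (ae_of_all _ hlim)
  have h1 : Tendsto (fun k => empMeanDiscrepancy S (u k) - meanDiscrepancy P Q (u k)) atTop
      (𝓝 (empMeanDiscrepancy S f - meanDiscrepancy P Q f)) := by
    refine Tendsto.sub (Tendsto.sub ?_ ?_) ((hint P ‹_›).sub (hint Q ‹_›))
    · exact (tendsto_finsetSum _ fun i _ => hlim (S.1 i)).const_mul _
    · exact (tendsto_finsetSum _ fun i _ => hlim (S.2 i)).const_mul _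
  refine le_of_tendsto' h1 fun k => ?_
  rw [empMeanDiscrepancy_eq, meanDiscrepancy_eq_sum P Q hN hM]
  exact le_ciSup (bddAbove_centered_sum (pooledLaw P Q N M) (φ := fun f : H₀ => f.1)
    (fun f => hH f.1 f.2) (weight N M) (pooled S)) ⟨u k, hu k⟩

end Sample

/-! ### The high probability event. -/

section Events

variable {X : Type*} [MeasurableSpace X] (P Q : Measure X) [IsProbabilityMeasure P]
  [IsProbabilityMeasure Q] {N M : ℕ}

/-- The event on which the empirical mean discrepancy is uniformly controlled over a pointwise
separable class, and the empirical mean discrepancy and second order moment of a fixed function on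
the unit sphere are close to their means. -/
theorem exists_event {H : Set (X → ℝ)} {ν τ : ℝ} (hν : 0 < ν) (hτ : 0 < τ) (hN : 0 < N)
    (hM : 0 < M) (hm : ∀ f ∈ H, Measurable f) (hsep : PointwiseSeparable H)
    (hH : ∀ f ∈ H, ∀ x, |f x| ≤ ν) {f₀ : X → ℝ} (hf₀ : f₀ ∈ H)
    (hf₁ : l2Norm (mixture P Q) f₀ = 1) :
    ∃ A : Set ((Fin N → X) × (Fin M → X)), MeasurableSet A ∧
      1 - 3 * Real.exp (-τ) ≤ (sampleLaw P Q N M).real A ∧ ∀ S ∈ A,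
        (∀ f ∈ H, empMeanDiscrepancy S f - meanDiscrepancy P Q f ≤
          2 * rademacher H S + √(18 * τ * ν ^ 2) / √(effectiveSize N M)) ∧
        meanDiscrepancy P Q f₀ - empMeanDiscrepancy S f₀ ≤
          √(2 * τ * ν ^ 2) / √(effectiveSize N M) ∧
        empOmega S f₀ - 1 ≤ √(τ * ν ^ 4 / 2) / √(effectiveSize N M) := by
  classical
  obtain ⟨H₀, hsub, hcount, hdense⟩ := hsep
  have hn := effectiveSize_pos hN hM
  have hw := sum_weight_sq hN hM
  set n := effectiveSize N M
  have := hcount.to_subtype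
  have hne : H₀.Nonempty := by
    obtain ⟨u, hu, -⟩ := hdense f₀ hf₀
    exact ⟨u 0, hu 0⟩
  have := hne.to_subtype
  set μ := pooledLaw P Q N M
  set v := weight N M
  -- Suprema over the countable dense subset are measurable; limits carry the bound to all of `H`.
  let φ : H₀ → X → ℝ := fun f => f.1
  have hφm : ∀ f, Measurable (φ f) := fun f => hm _ (hsub f.2)
  have hφ : ∀ f x, |φ f x| ≤ ν := fun f => hH _ (hsub f.2)
  have hsq : ∀ x, |f₀ x ^ 2| ≤ ν ^ 2 := fun x => by
    rw [abs_pow]; exact pow_le_pow_left₀ (abs_nonneg _) (hH f₀ hf₀ x) 2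
  have hsqm : Measurable fun x => f₀ x ^ 2 := (hm f₀ hf₀).pow_const 2
  have hv1 : ∑ i, (-v i) ^ 2 = 1 / n := by simp_rw [neg_sq]; exact hw
  have hv2 : ∑ i, (|v i| / 2) ^ 2 = 1 / n / 4 := by
    simp_rw [div_pow, sq_abs, ← Finset.sum_div]
    rw [hw, show (2 : ℝ) ^ 2 = 4 by norm_num]
  have p1 := measure_supDeviation_ge_le μ hφm hφ hν (v := v) (by rw [hw]; positivity) hτ.le
  -- Negated weights give the lower deviation of the mean discrepancy; in `p3`, halved absolute
  -- weights turn squares into the second order moment.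
  have p2 := measure_weighted_sum_ge_le μ (hm f₀ hf₀) (hH f₀ hf₀) hν (v := fun i => -v i)
    (by rw [hv1]; positivity) hτ.le
  have p3 := measure_weighted_sum_ge_le μ hsqm hsq (by positivity) (v := fun i => |v i| / 2)
    (by rw [hv2]; positivity) hτ.le
  rw [hw, mul_one_div, Real.sqrt_div' _ hn.le] at p1
  rw [hv1, mul_one_div, Real.sqrt_div' _ hn.le] at p2
  rw [hv2, show 2 * τ * (ν ^ 2) ^ 2 * (1 / n / 4) = τ * ν ^ 4 / 2 / n by ring,
    Real.sqrt_div' _ hn.le, sum_half_abs_weight_mul_integral P Q hN hM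
      (Integrable.of_bound hsqm.aestronglyMeasurable _ (ae_of_all _ hsq))
      (Integrable.of_bound hsqm.aestronglyMeasurable _ (ae_of_all _ hsq)),
    ← l2Norm_sq, hf₁, one_pow] at p3
  set B₁ := {z | √(18 * τ * ν ^ 2) / √n ≤ supDeviation μ φ v z - 2 * signAverage φ v z}
  set B₂ := {z : Fin N ⊕ Fin M → X | ∑ i, -v i * ∫ x, f₀ x ∂μ i + √(2 * τ * ν ^ 2) / √n ≤
    ∑ i, -v i * f₀ (z i)}
  set B₃ := {z : Fin N ⊕ Fin M → X | 1 + √(τ * ν ^ 4 / 2) / √n ≤ ∑ i, |v i| / 2 * f₀ (z i) ^ 2}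
  have hB : MeasurableSet (B₁ ∪ B₂ ∪ B₃) :=
    ((measurableSet_le measurable_const ((measurable_supDeviation μ hφm v).sub
      ((measurable_signAverage hφm v).const_mul 2))).union
      (measurableSet_le measurable_const (measurable_weighted_sum (hm f₀ hf₀) _))).union
      (measurableSet_le measurable_const (measurable_weighted_sum hsqm _))
  have hpool := measurePreserving_pooled P Q (N := N) (M := M)
  -- Three bad events, each of probability at most `exp (-τ)`.
  refine ⟨pooled ⁻¹' (B₁ ∪ B₂ ∪ B₃)ᶜ, hpool.measurable hB.compl, ?_, fun S hS => ?_⟩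
  · rw [measureReal_def, hpool.measure_preimage hB.compl.nullMeasurableSet, ← measureReal_def,
      probReal_compl_eq_one_sub hB]
    have h1 := measureReal_union_le (μ := Measure.pi μ) (B₁ ∪ B₂) B₃
    have h2 := measureReal_union_le (μ := Measure.pi μ) B₁ B₂
    linarith
  · simp only [Set.mem_preimage, Set.mem_compl_iff, Set.mem_union, not_or] at hS
    obtain ⟨⟨h1, h2⟩, h3⟩ := hS
    replace h1 : supDeviation μ φ v (pooled S) - 2 * signAverage φ v (pooled S) <
      √(18 * τ * ν ^ 2) / √n := lt_of_not_ge h1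
    replace h2 : ∑ i, -v i * f₀ (pooled S i) <
      ∑ i, -v i * ∫ x, f₀ x ∂μ i + √(2 * τ * ν ^ 2) / √n := lt_of_not_ge h2
    replace h3 : ∑ i, |v i| / 2 * f₀ (pooled S i) ^ 2 < 1 + √(τ * ν ^ 4 / 2) / √n :=
      lt_of_not_ge h3
    refine ⟨fun f hf => ?_, ?_, ?_⟩
    · obtain ⟨u, hu, hlim⟩ := hdense f hf
      have h4 := empMeanDiscrepancy_sub_le_supDeviation P Q hN hM (fun f hf => hm f (hsub hf))
        (fun f hf => hH f (hsub hf)) hu hlim S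
      have h5 := rademacher_mono hsub hne hH S
      rw [rademacher_eq_signAverage] at h5
      have h6 : signAverage φ v (pooled S) ≤ rademacher H S := h5
      change _ ≤ supDeviation μ φ v (pooled S) at h4
      linarith
    · rw [empMeanDiscrepancy_eq, meanDiscrepancy_eq_sum P Q hN hM]
      simp only [neg_mul, Finset.sum_neg_distrib] at h2
      linarith
    · rw [empOmega_eq]
      linarith

end Events

end FisherIPM

/-! ### The excess risk bound. -/

theorem theorem3 :
    ∃ c₁ c₂ c₃ c₄ : ℝ, 0 < c₁ ∧ 0 < c₂ ∧ 0 < c₃ ∧ 0 < c₄ ∧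
      ∀ ν τ Λ : ℝ, 0 < ν → 0 < τ → 0 ≤ Λ →
        ∃ C : ℝ,
          ∀ (X : Type*) [MeasurableSpace X] (P Q : Measure X)
            [IsProbabilityMeasure P] [IsProbabilityMeasure Q] (H : Set (X → ℝ)) (N M : ℕ),
            P ≠ Q → 0 < N → 0 < M →
            (∀ f ∈ H, Measurable f) → PointwiseSeparable H →
            (∀ f ∈ H, ∀ x, |f x| ≤ ν) →
            (H ∩ unitSphere P Q).Nonempty →
            ∃ A : Set ((Fin N → X) × (Fin M → X)), MeasurableSet A ∧
              1 - 12 * Real.exp (-τ) ≤ (sampleLaw P Q N M).real A ∧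
              ∀ S ∈ A, ∀ (fhat : X → ℝ) (lamhat η : ℝ),
                IsEmpiricalCritic H S fhat →
                IsEmpiricalSaddlePoint H S fhat lamhat → lamhat ≤ Λ →
                c₁ * ν * rademacher H S + c₂ * (ν ^ 2 * τ / effectiveSize N M) ≤ η →
                (chi2 P Q - meanDiscrepancy P Q fhat) / chi2 P Q ≤
                  approximationError P Q H +
                    (c₃ * rademacher (empSublevel H S (1 + ν ^ 2 + 2 * η)) S +
                      c₄ * (1 + 2 * ν * lamhat) *
                        rademacher (empSublevel H S (1 + ν ^ 2 / 2 + η)) S +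
                      C / √(effectiveSize N M)) / chi2 P Q := by
  -- `c₃ = 2` is the symmetrization factor. The summands of `C` come from the slack in choosing
  -- `f₀`, the uniform deviation, the mean of `f₀`, and its second moment times `Λ / 2`.
  refine ⟨1, 1, 2, 1, one_pos, one_pos, two_pos, one_pos, fun ν τ Λ hν hτ hΛ =>
    ⟨1 + √(18 * τ * ν ^ 2) + √(2 * τ * ν ^ 2) + Λ / 2 * √(τ * ν ^ 4 / 2), ?_⟩⟩
  intro X _ P Q _ _ H N M hPQ hN hM hm hsep hH hne
  have hχ := chi2_pos P Q hPQ
  have hn := effectiveSize_pos hN hM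
  have hs : 0 < √(effectiveSize N M) := Real.sqrt_pos.2 hn
  obtain ⟨f₀, hf₀, hf₁, happrox⟩ := exists_relative_loss_lt P Q hPQ hm hH hne
    (δ := 1 / √(effectiveSize N M) / chi2 P Q) (by positivity)
  obtain ⟨A, hA, hprob, hdev⟩ := exists_event P Q hν hτ hN hM hm hsep hH hf₀ hf₁
  refine ⟨A, hA, hprob.trans' (by linarith [Real.exp_pos (-τ)]), ?_⟩
  intro S hS fhat lamhat η hcrit hsaddle hlam hη
  obtain ⟨hunif, hmean, homega⟩ := hdev S hS
  have hRH := rademacher_nonneg hH S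
  have hη₀ : 0 ≤ η := le_trans (by positivity) hη
  rw [empSublevel_eq_self hN hM hH S (show ν ^ 2 ≤ 1 + ν ^ 2 + 2 * η by linarith)]
  have hR' : 0 ≤ 1 * (1 + 2 * ν * lamhat) *
      rademacher (empSublevel H S (1 + ν ^ 2 / 2 + η)) S := by
    have := hsaddle.2.1
    exact mul_nonneg (by positivity) (rademacher_nonneg (fun f hf => hH f hf.1) S)
  -- The constraint term vanishes at `fhat`, so the saddle inequality charges `f₀` only for its
  -- excess second moment.
  have hopt : empMeanDiscrepancy S f₀ - empMeanDiscrepancy S fhat ≤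
      Λ / 2 * (√(τ * ν ^ 4 / 2) / √(effectiveSize N M)) := by
    have h1 := hsaddle.2.2.1 f₀ hf₀
    simp only [empLagrangian, hcrit.2.1, sub_self, mul_zero, add_zero] at h1
    have h2 : lamhat / 2 * (empOmega S f₀ - 1) ≤
        Λ / 2 * (√(τ * ν ^ 4 / 2) / √(effectiveSize N M)) :=
      mul_le_mul_of_nonneg (by linarith) homega (by linarith [hsaddle.2.1]) (by positivity)
    linarith
  have hfhat := hunif fhat hcrit.1
  calc (chi2 P Q - meanDiscrepancy P Q fhat) / chi2 P Q
      = (chi2 P Q - meanDiscrepancy P Q f₀) / chi2 P Q +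
          (meanDiscrepancy P Q f₀ - meanDiscrepancy P Q fhat) / chi2 P Q := by ring
    _ ≤ approximationError P Q H + (1 / √(effectiveSize N M) / chi2 P Q +
          (meanDiscrepancy P Q f₀ - meanDiscrepancy P Q fhat) / chi2 P Q) := by linarith
    _ ≤ _ := by
        rw [← add_div]
        refine add_le_add le_rfl (div_le_div_of_nonneg_right ?_ hχ.le)
        rw [add_div, add_div, add_div, mul_div_assoc (Λ / 2)]
        linarith
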